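/- **Distances, lengths.** Let $d$ be a distance function on a set $X$. A curve $c:[a,b]\to X$ is $d$-Lipschitz if $d(c(s),c(t))\le K|s-t|$ for some constant $K$; its length is its variation $$L_d(c)=\sup\Big\{\sum_{i=0}^{n-1} d(c(t_i),c(t_{i+1})) : a\le t_0\le t_1\le\dots\le t_n\le b\Big\}.$$ $d$ is a *length distance* if any two points are joined by a $d$-Lipschitz curve and $d(x,y)$ is the infimum of $L_d(c)$ over all $d$-Lipschitz curves $c$ from $x$ to $y$. **Dilatation structures.** Let $(\Omega,\bar d)$ be a complete metric space whose closed balls of radius $3$ are compact; $B(x,r)$ and $\bar B(x,r)$ are the open and closed $\bar d$-balls. A *dilatation structure* $(\Omega,\bar d,\bar\delta)$ consists of homeomorphisms $\bar\delta^x_\varepsilon:U(x)\to V_\varepsilon(x)$ for $x\in\Omega$, $0<\varepsilon\le1$, and $\bar\delta^x_\varepsilon:W_\varepsilon(x)\to U(x)$ for $\varepsilon>1$ such that: * (A0) There are numbers $1<A<B$ with $\bar B(x,A)\subset U(x)$ and $B(x,\varepsilon)\subset\bar\delta^x_\varepsilon(B(x,A))\subset V_\varepsilon(x)\subset W_{\varepsilon^{-1}}(x)\subset\bar\delta^x_\varepsilon(B(x,B)\cap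 U(x))$ for all $x$ and $\varepsilon\in(0,1)$. For each compact $K$ there are $R>0$, $\varepsilon_0\in(0,1)$ such that for $x\in K$, $u,v\in\bar B(x,R)\subset U(x)$ and $\varepsilon\in(0,\varepsilon_0)$ one has $\bar\delta^x_\varepsilon v\in W_{\varepsilon^{-1}}(\bar\delta^x_\varepsilon u)$. * (A1) $\bar\delta^x_\varepsilon x=x$ and $\bar\delta^x_1=\mathrm{id}$. The map $(\varepsilon,x,y)\mapsto\bar\delta^x_\varepsilon y$, defined for $0<\varepsilon\le 1$, $y\in U(x)$ and for $\varepsilon>1$, $y\in W_\varepsilon(x)$, extends continuously to the closure of its domain in $[0,\infty)\times\Omega\times\Omega$, and $\lim_{\varepsilon\to0}\bar\delta^x_\varepsilon y=x$ for $y\in U(x)$. * (A2) $\bar\delta^x_\varepsilon\bar\delta^x_\mu u=\bar\delta^x_{\varepsilon\mu}u$ for $u\in U(x)$ and $\varepsilon,\mu>0$ whenever both sides are defined. * (A3) For each $x$ there is a distance function $\bar d^x$ on $\bar B(x,A)$ such that $\sup\{|\tfrac1\varepsilon\bar d(\bar\delta^x_\varepsilon u,\bar\delta^x_\varepsilon v)-\bar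 d^x(u,v)| : u,v\in\bar B(x,A)\}\to0$ as $\varepsilon\to0$, uniformly for $x$ in compact sets. It is *strong* if, moreover, * (A4) $\bar\delta_{\varepsilon^{-1}}^{\bar\delta^x_\varepsilon u}\bar\delta^x_\varepsilon v$ converges as $\varepsilon\to0$ to some $\Delta^x(u,v)$, uniformly for $x$ in any given compact set $K$ and $u,v\in\bar B(x,R)$, where $R>0$ may depend on $K$. **Radon–Nikodym property.** A curve $c:[a,b]\to\Omega$ is derivable at $t\in(a,b)$ if, with $x=c(t)$, there are $r>0$ and $f:(-r,r)\to U(x)$ with $f(\mu s)=\bar\delta^x_\mu f(s)$ for $0<\mu\le1$, $|s|<r$, and $f(s+s')=\lim_{\varepsilon\to0}\bar\delta^x_{\varepsilon^{-1}}\bar\delta^{\bar\delta^x_\varepsilon f(s)}_\varepsilon f(s')$ whenever $|s|,|s'|,|s+s'|<r$ (that is, $f$ is a local morphism from $\mathbb R$ to the tangent conical group at $x$), such that $\lim_{\varepsilon\to0,\,\varepsilon>0}\tfrac1\varepsilon\bar d(c(t+\varepsilon s),\bar\delta^x_\varepsilon f(s))=0$ for each $|s|<r$. The structure has the *Radon–Nikodym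 property* if each $\bar d$-Lipschitz curve $c:[a,b]\to\Omega$ is derivable at almost every $t$. **The class $\mathcal D$.** For $0<k<C$ let $\mathcal D_{k,C}(\Omega,\bar d,\bar\delta)$ be the set of length distances $d$ on $\Omega$ such that for each $\varepsilon>0$ and each compact $K\subset\Omega$ there is $\eta>0$ with $$k\,\bar d^x(u,v)\le\tfrac1\varepsilon d(\bar\delta^x_\varepsilon u,\bar\delta^x_\varepsilon v)\le C\,\bar d^x(u,v)$$ for all $x,u,v\in K$ whose mutual $\bar d$-distances are at most $\eta$. The structure is *tempered* if $\bar d\in\mathcal D_{k',C'}(\Omega,\bar d,\bar\delta)$ for some $0<k'<C'$. **Theorem.** Let $(\Omega,\bar d,\bar\delta)$ be a tempered strong dilatation structure with the Radon–Nikodym property, let $0<k<C$, and let $d_n,d\in\mathcal D_{k,C}(\Omega,\bar d,\bar\delta)$ be such that $d_n\to d$ uniformly on compact subsets of $\Omega\times\Omega$. Let $L_n=L_{d_n}$ and $L=L_d$, defined on the sets $Z_n$ and $Z_0$ of those curves in $C([0,1],\Omega)$ that are $d_n$-Lipschitz, respectively $d$-Lipschitz, where $C([0,1],\Omega)$ carries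 the distance of uniform convergence with respect to $\bar d$. Then $L_n$ $\Gamma$-converges to $L$: * if $c_n\in Z_n$, $c\in Z_0$ and $c_n\to c$ uniformly, then $L(c)\le\liminf_{n\to\infty}L_n(c_n)$; * for each $c\in Z_0$ there are $c_n\in Z_n$ with $c_n\to c$ uniformly and $\lim_{n\to\infty}L_n(c_n)=L(c)$. -/

import Mathlib

open Set Filter Topology MeasureTheory
open scoped ENNReal

/-- `d` satisfies the axioms of a distance function on the set `s`. -/
structure IsDistanceOn {X : Type*} (s : Set X) (d : X → X → ℝ) : Prop where
  nonneg : ∀ x ∈ s, ∀ y ∈ s, 0 ≤ d x y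
  eq_zero_iff : ∀ x ∈ s, ∀ y ∈ s, (d x y = 0 ↔ x = y)
  symm : ∀ x ∈ s, ∀ y ∈ s, d x y = d y x
  triangle : ∀ x ∈ s, ∀ y ∈ s, ∀ z ∈ s, d x z ≤ d x y + d y z

/-- The curve `c`, restricted to the parameter set `s`, is Lipschitz for the distance `d`. -/
def IsLipCurveOn {X α : Type*} [PseudoMetricSpace α] (d : X → X → ℝ) (c : α → X)
    (s : Set α) : Prop :=
  ∃ K : ℝ, 0 ≤ K ∧ ∀ t ∈ s, ∀ t' ∈ s, d (c t) (c t') ≤ K * dist t t'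

/-- The length (variation) of the curve `c` over the parameter set `s` for the distance `d`: the
supremum of `∑ d (c (t i)) (c (t (i + 1)))` over all finite increasing families in `s`. -/
noncomputable def curveLength {X α : Type*} [Preorder α] (d : X → X → ℝ) (c : α → X)
    (s : Set α) : ℝ≥0∞ :=
  ⨆ p : ℕ × { t : ℕ → α // Monotone t ∧ ∀ i, t i ∈ s },
    ∑ i ∈ Finset.range p.1, ENNReal.ofReal (d (c (p.2.1 i)) (c (p.2.1 (i + 1))))

/-- `d` is a length distance: `d x y` is the infimum of the `d`-lengths of the `d`-Lipschitz curves
from `x` to `y`. (Such a curve exists: the infimum of the empty set would be `∞`.) -/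
def IsLengthDistance {X : Type*} (d : X → X → ℝ) : Prop :=
  IsDistanceOn univ d ∧
  ∀ x y : X, IsGLB
    {l : ℝ≥0∞ | ∃ (a b : ℝ) (c : ℝ → X), a ≤ b ∧ IsLipCurveOn d c (Icc a b) ∧
      c a = x ∧ c b = y ∧ l = curveLength d c (Icc a b)}
    (ENNReal.ofReal (d x y))

/-- `f` restricts to a homeomorphism from the set `s` onto the set `t`. -/
def IsHomeoOn {X Y : Type*} [TopologicalSpace X] [TopologicalSpace Y] (f : X → Y)
    (s : Set X) (t : Set Y) : Prop :=
  MapsTo f s t ∧ ContinuousOn f s ∧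
  ∃ g : Y → X, MapsTo g t s ∧ ContinuousOn g t ∧ InvOn g f s t

/-- The data of a dilatation structure on `X`: the domains and codomains `U x`, `V ε x`, `W ε x`,
the dilatations `δ x ε` (only the values on `U x` for `0 < ε ≤ 1` and on `W ε x` for `1 < ε` are
meaningful), the constants `A`, `B`, and the tangent distances `tdist x` (only the values on the
closed ball of radius `A` around `x` are meaningful). -/
structure DilatationData (X : Type*) where
  U : X → Set X
  V : ℝ → X → Set X
  W : ℝ → X → Set X
  δ : X → ℝ → X → X
  A : ℝ
  B : ℝ
  tdist : X → X → X → ℝ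

namespace DilatationData

/-- The set of all `(ε, x, y)` for which `δ x ε y` is defined. -/
def dom {X : Type*} (S : DilatationData X) : Set (ℝ × X × X) :=
  {p | 0 < p.1 ∧ (p.1 ≤ 1 → p.2.2 ∈ S.U p.2.1) ∧ (1 < p.1 → p.2.2 ∈ S.W p.1 p.2.1)}

/-- The approximate difference `δ^{δ^x_ε u}_{1/ε} (δ^x_ε v)`. -/
noncomputable def approxDiff {X : Type*} (S : DilatationData X) (ε : ℝ) (x u v : X) : X :=
  S.δ (S.δ x ε u) ε⁻¹ (S.δ x ε v)

/-- The approximate sum `δ^x_{1/ε} (δ^{δ^x_ε u}_ε v)`. Its limit as `ε → 0` is the group operation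
of the tangent space at `x`. -/
noncomputable def approxSum {X : Type*} (S : DilatationData X) (ε : ℝ) (x u v : X) : X :=
  S.δ x ε⁻¹ (S.δ (S.δ x ε u) ε v)

/-- The axioms of a dilatation structure over the metric space `X`. -/
structure IsDilatationStructure {X : Type*} [MetricSpace X] (S : DilatationData X) : Prop where
  complete : CompleteSpace X
  isCompact_closedBall : ∀ x : X, IsCompact (Metric.closedBall x 3)
  homeo_of_le_one : ∀ (x : X) (ε : ℝ), 0 < ε → ε ≤ 1 → IsHomeoOn (S.δ x ε) (S.U x) (S.V ε x)
  homeo_of_one_lt : ∀ (x : X) (ε : ℝ), 1 < ε → IsHomeoOn (S.δ x ε) (S.W ε x) (S.U x)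
  -- A0
  one_lt_A : 1 < S.A
  A_lt_B : S.A < S.B
  closedBall_subset : ∀ x : X, Metric.closedBall x S.A ⊆ S.U x
  inclusions : ∀ (x : X) (ε : ℝ), 0 < ε → ε < 1 →
    Metric.ball x ε ⊆ S.δ x ε '' Metric.ball x S.A ∧
    S.δ x ε '' Metric.ball x S.A ⊆ S.V ε x ∧
    S.V ε x ⊆ S.W ε⁻¹ x ∧
    S.W ε⁻¹ x ⊆ S.δ x ε '' (Metric.ball x S.B ∩ S.U x)
  exists_radius : ∀ K : Set X, IsCompact K → ∃ R > 0, ∃ ε₀ : ℝ, 0 < ε₀ ∧ ε₀ < 1 ∧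
    ∀ x ∈ K, Metric.closedBall x R ⊆ S.U x ∧
      ∀ u ∈ Metric.closedBall x R, ∀ v ∈ Metric.closedBall x R, ∀ ε : ℝ, 0 < ε → ε < ε₀ →
        S.δ x ε v ∈ S.W ε⁻¹ (S.δ x ε u)
  -- A1
  map_center : ∀ (x : X) (ε : ℝ), 0 < ε → S.δ x ε x = x
  map_one : ∀ x : X, ∀ u ∈ S.U x, S.δ x 1 u = u
  continuous_extension : ∃ g : ℝ × X × X → X, ContinuousOn g (closure S.dom) ∧
    ∀ p ∈ S.dom, g p = S.δ p.2.1 p.1 p.2.2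
  tendsto_center : ∀ x : X, ∀ y ∈ S.U x, Tendsto (fun ε : ℝ => S.δ x ε y) (𝓝[>] 0) (𝓝 x)
  -- A2
  map_mul : ∀ (x : X) (ε μ : ℝ), 0 < ε → 0 < μ → ∀ u ∈ S.U x,
    (μ, x, u) ∈ S.dom → (ε, x, S.δ x μ u) ∈ S.dom → (ε * μ, x, u) ∈ S.dom →
      S.δ x ε (S.δ x μ u) = S.δ x (ε * μ) u
  -- A3
  tdist_isDistanceOn : ∀ x : X, IsDistanceOn (Metric.closedBall x S.A) (S.tdist x)
  tdist_limit : ∀ K : Set X, IsCompact K → ∀ η > 0, ∃ ε₀ : ℝ, 0 < ε₀ ∧ ε₀ ≤ 1 ∧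
    ∀ ε : ℝ, 0 < ε → ε < ε₀ → ∀ x ∈ K,
      ∀ u ∈ Metric.closedBall x S.A, ∀ v ∈ Metric.closedBall x S.A,
        |1 / ε * dist (S.δ x ε u) (S.δ x ε v) - S.tdist x u v| ≤ η

/-- A strong dilatation structure: the approximate differences converge, uniformly for `x` in a
compact set and `u`, `v` close to `x`. -/
structure IsStrong {X : Type*} [MetricSpace X] (S : DilatationData X) : Prop
    extends S.IsDilatationStructure where
  -- A4
  approxDiff_limit : ∃ D : X → X → X → X, ∀ K : Set X, IsCompact K → ∃ R > 0,
    ∀ η > 0, ∃ ε₀ : ℝ, 0 < ε₀ ∧ ε₀ ≤ 1 ∧ ∀ ε : ℝ, 0 < ε → ε < ε₀ → ∀ x ∈ K,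
      ∀ u ∈ Metric.closedBall x R, ∀ v ∈ Metric.closedBall x R,
        dist (S.approxDiff ε x u v) (D x u v) ≤ η

/-- `f`, on the interval `(-r, r)`, is a morphism from `ℝ` (with addition and multiplication by
positive scalars) to the tangent space at `x`: the (local) group with the operation
`lim S.approxSum ε x` and the dilatations `S.δ x`. (Compatibility with `δ x μ` for `μ > 1` is the
same as compatibility with its inverse `δ x μ⁻¹`.) -/
def IsTangentMorphism {X : Type*} [MetricSpace X] (S : DilatationData X) (x : X) (r : ℝ)
    (f : ℝ → X) : Prop :=
  (∀ s : ℝ, |s| < r → f s ∈ S.U x) ∧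
  (∀ s μ : ℝ, |s| < r → 0 < μ → μ ≤ 1 → f (μ * s) = S.δ x μ (f s)) ∧
  (∀ s t : ℝ, |s| < r → |t| < r → |s + t| < r →
    Tendsto (fun ε : ℝ => S.approxSum ε x (f s) (f t)) (𝓝[>] 0) (𝓝 (f (s + t))))

/-- The curve `c` is derivable at the interior parameter `t`. -/
def IsDerivableAt {X : Type*} [MetricSpace X] (S : DilatationData X) (c : ℝ → X) (t : ℝ) : Prop :=
  ∃ r > 0, ∃ f : ℝ → X, S.IsTangentMorphism (c t) r f ∧
    ∀ s : ℝ, |s| < r →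
      Tendsto (fun ε : ℝ => 1 / ε * dist (c (t + ε * s)) (S.δ (c t) ε (f s))) (𝓝[>] 0) (𝓝 0)

/-- The Radon-Nikodym property: Lipschitz curves are derivable almost everywhere. -/
def HasRadonNikodym {X : Type*} [MetricSpace X] (S : DilatationData X) : Prop :=
  ∀ (a b : ℝ) (c : ℝ → X), a < b → IsLipCurveOn dist c (Icc a b) →
    ∀ᵐ t ∂(volume.restrict (Ioo a b)), S.IsDerivableAt c t

/-- The class of length distances `d` on `X` such that, for every `ε > 0`, the distances
`(1 / ε) * d (δ^x_ε u) (δ^x_ε v)` and `d^x u v` are comparable with the constants `k`, `C` for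
`x`, `u`, `v` sufficiently close (locally uniformly). -/
def distanceClass {X : Type*} [MetricSpace X] (S : DilatationData X) (k C : ℝ) :
    Set (X → X → ℝ) :=
  {d | IsLengthDistance d ∧
    ∀ ε : ℝ, 0 < ε → ∀ K : Set X, IsCompact K → ∃ η > 0, ∀ x ∈ K, ∀ u ∈ K, ∀ v ∈ K,
      dist x u ≤ η → dist x v ≤ η → dist u v ≤ η →
        k * S.tdist x u v ≤ 1 / ε * d (S.δ x ε u) (S.δ x ε v) ∧
        1 / ε * d (S.δ x ε u) (S.δ x ε v) ≤ C * S.tdist x u v}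

/-- The dilatation structure is tempered. -/
def IsTempered {X : Type*} [MetricSpace X] (S : DilatationData X) : Prop :=
  ∃ k C : ℝ, 0 < k ∧ k < C ∧ (dist : X → X → ℝ) ∈ S.distanceClass k C

end DilatationData

/-- Gamma-convergence of a sequence of functionals `F n`, defined on subsets `Z n` of a metric space,
to a functional `F₀`, defined on the subset `Z₀`. -/
def GammaConverges {Y : Type*} [MetricSpace Y] (Z : ℕ → Set Y) (F : ℕ → Y → ℝ≥0∞)
    (Z₀ : Set Y) (F₀ : Y → ℝ≥0∞) : Prop :=
  (∀ (y : ℕ → Y) (y₀ : Y), (∀ n, y n ∈ Z n) → y₀ ∈ Z₀ → Tendsto y atTop (𝓝 y₀) →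
    F₀ y₀ ≤ liminf (fun n => F n (y n)) atTop) ∧
  (∀ y₀ ∈ Z₀, ∃ y : ℕ → Y, (∀ n, y n ∈ Z n) ∧ Tendsto y atTop (𝓝 y₀) ∧
    Tendsto (fun n => F n (y n)) atTop (𝓝 (F₀ y₀)))

/-- The continuous curves `[0, 1] → X` that are Lipschitz for the distance `d`. -/
def lipCurves {X : Type*} [MetricSpace X] (d : X → X → ℝ) : Set C(unitInterval, X) :=
  {c | IsLipCurveOn d c univ}

/-- The length functional induced by the distance `d` on the curves `[0, 1] → X`. -/
noncomputable def lengthFunctional {X : Type*} [MetricSpace X] (d : X → X → ℝ)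
    (c : C(unitInterval, X)) : ℝ≥0∞ :=
  curveLength d c univ

/-!
The class condition at the scale `ε = 1`, where the dilatations are the identity, compares a distance
`d` of the class on compact sets and at small distances with the tangent distances
(`DilatationData.IsDilatationStructure.locally_le_mul`). Temperedness does the same for the ambient
metric, so `d` and `dist` are comparable locally, with constants `M`, `M'` depending only on the
constants of the two classes. Both are length distances, and summing local inequalities along
curves gives the global inequalities `d ≤ M' * dist` and `dist ≤ M * d`.

For the first one the curves are continuous with compact image (`IsDistanceOn.le_mul_dist`). For the
second one the curves are only known to be `d`-Lipschitz, and might escape to infinity while staying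
close for `d`. This is excluded by a Baire category argument on the closed set of parameters near
which the curve is unbounded (`IsDistanceOn.isBounded_image`). It uses that closed balls of any radius
are compact, which follows from the compactness of the balls of radius `3` because the metric is a
length distance (`properSpace_of_isLengthDistance`).

The distances `d n` are therefore uniformly equivalent to the metric, and pointwise convergence
`d n → d₀` is enough for Gamma-convergence (`gammaConverges_lengthFunctional`). The lower bound holds
for the sum over each fixed partition. For the upper bound, the pieces of the limit curve between the
points `i / N` are replaced by nearly `d n`-shortest curves
(`IsLengthDistance.exists_lipCurve_near`): the new curve is at distance `O(1 / N)` from the old one,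
uniformly in `n`, and its `d n`-length is at most `1 / N` more than the sum of the distances of the
consecutive points for `d n`, which tends to the sum for `d₀`.
-/

/-! ### Length of curves -/

theorem sum_le_curveLength {X α : Type*} [Preorder α] (d : X → X → ℝ) (c : α → X) {s : Set α}
    (n : ℕ) {t : ℕ → α} (ht : Monotone t) (hts : ∀ i, t i ∈ s) :
    ∑ i ∈ Finset.range n, ENNReal.ofReal (d (c (t i)) (c (t (i + 1)))) ≤ curveLength d c s :=
  le_iSup (fun p : ℕ × { t : ℕ → α // Monotone t ∧ ∀ i, t i ∈ s } =>
    ∑ i ∈ Finset.range p.1, ENNReal.ofReal (d (c (p.2.1 i)) (c (p.2.1 (i + 1))))) ⟨n, t, ht, hts⟩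

theorem curveLength_comp_le {X α β : Type*} [Preorder α] [Preorder β] (d : X → X → ℝ) (c : β → X)
    {φ : α → β} {s : Set α} {t : Set β} (hφ : Monotone φ) (hst : MapsTo φ s t) :
    curveLength d (c ∘ φ) s ≤ curveLength d c t :=
  iSup_le fun p => sum_le_curveLength d c p.1 (hφ.comp p.2.2.1) fun i => hst (p.2.2.2 i)

theorem curveLength_congr {X α : Type*} [Preorder α] (d : X → X → ℝ) {c c' : α → X} {s : Set α}
    (h : EqOn c c' s) : curveLength d c s = curveLength d c' s := by
  refine iSup_congr fun p => Finset.sum_congr rfl fun i _ => ?_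
  rw [h (p.2.2.2 i), h (p.2.2.2 (i + 1))]

theorem curveLength_le_of_lipschitz {X : Type*} {d : X → X → ℝ} {c : ℝ → X} {a b K : ℝ}
    (hK : 0 ≤ K) (hc : ∀ s ∈ Icc a b, ∀ t ∈ Icc a b, d (c s) (c t) ≤ K * dist s t) :
    curveLength d c (Icc a b) ≤ ENNReal.ofReal (K * (b - a)) := by
  refine iSup_le fun ⟨n, t, ht, hts⟩ => ?_
  calc ∑ i ∈ Finset.range n, ENNReal.ofReal (d (c (t i)) (c (t (i + 1))))
      ≤ ∑ i ∈ Finset.range n, ENNReal.ofReal (K * (t (i + 1) - t i)) := by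
        refine Finset.sum_le_sum fun i _ => ENNReal.ofReal_le_ofReal ?_
        have h := hc _ (hts i) _ (hts (i + 1))
        rwa [dist_comm, Real.dist_eq, abs_of_nonneg (sub_nonneg.2 (ht i.le_succ))] at h
    _ = ENNReal.ofReal (K * (t n - t 0)) := by
        rw [← ENNReal.ofReal_sum_of_nonneg
          fun i _ => mul_nonneg hK (sub_nonneg.2 (ht i.le_succ)), ← Finset.mul_sum,
          Finset.sum_range_sub]
    _ ≤ ENNReal.ofReal (K * (b - a)) :=
        ENNReal.ofReal_le_ofReal (mul_le_mul_of_nonneg_left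
          (sub_le_sub (hts n).2 (hts 0).1) hK)

/-- The distance function `d` as a (pseudo)metric structure, in general unrelated to an ambient
metric; it gives access to the library theory of the variation. -/
abbrev IsDistanceOn.toPseudoMetricSpace {X : Type*} {d : X → X → ℝ} (hd : IsDistanceOn univ d) :
    PseudoMetricSpace X where
  dist := d
  dist_self x := (hd.eq_zero_iff x trivial x trivial).2 rfl
  dist_comm x y := hd.symm x trivial y trivial
  dist_triangle x y z := hd.triangle x trivial y trivial z trivial

theorem IsDistanceOn.curveLength_eq_eVariationOn {X α : Type*} [LinearOrder α] {d : X → X → ℝ}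
    (hd : IsDistanceOn univ d) (c : α → X) (s : Set α) :
    curveLength d c s =
      @eVariationOn α _ X hd.toPseudoMetricSpace.toPseudoEMetricSpace c s := by
  let := hd.toPseudoMetricSpace
  refine iSup_congr fun p => Finset.sum_congr rfl fun i _ => ?_
  rw [edist_comm, edist_dist]
  rfl

theorem IsDistanceOn.curveLength_Icc_add_Icc {X α : Type*} [LinearOrder α] {d : X → X → ℝ}
    (hd : IsDistanceOn univ d) (c : α → X) {p q r : α} (hpq : p ≤ q) (hqr : q ≤ r) :
    curveLength d c (Icc p q) + curveLength d c (Icc q r) = curveLength d c (Icc p r) := by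
  let := hd.toPseudoMetricSpace
  simp only [hd.curveLength_eq_eVariationOn]
  have h := eVariationOn.Icc_add_Icc c (s := univ) hpq hqr (mem_univ q)
  simpa only [univ_inter] using h

theorem IsDistanceOn.le_curveLength {X α : Type*} [LinearOrder α] {d : X → X → ℝ}
    (hd : IsDistanceOn univ d) (c : α → X) {s : Set α} {p q : α} (hp : p ∈ s) (hq : q ∈ s) :
    ENNReal.ofReal (d (c p) (c q)) ≤ curveLength d c s := by
  let := hd.toPseudoMetricSpace
  rw [hd.curveLength_eq_eVariationOn]
  have h := eVariationOn.edist_le c hp hq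
  rwa [edist_dist] at h

theorem IsDistanceOn.le_sum_range {X : Type*} {d : X → X → ℝ} (hd : IsDistanceOn univ d)
    (x : ℕ → X) (n : ℕ) : d (x 0) (x n) ≤ ∑ i ∈ Finset.range n, d (x i) (x (i + 1)) := by
  let := hd.toPseudoMetricSpace
  exact dist_le_range_sum_dist x n

/-! ### Comparison of length distances -/

/-- The points dividing `[a, b]` into `N` equal parts, continued constantly after `b`. -/
noncomputable def divisionPoint (a b : ℝ) (N i : ℕ) : ℝ := a + (b - a) * (((min i N : ℕ) : ℝ) / N)

theorem divisionPoint_zero (a b : ℝ) (N : ℕ) : divisionPoint a b N 0 = a := by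
  simp [divisionPoint]

theorem divisionPoint_self (a b : ℝ) {N : ℕ} (hN : N ≠ 0) : divisionPoint a b N N = b := by
  simp [divisionPoint, hN]

theorem monotone_divisionPoint {a b : ℝ} (hab : a ≤ b) (N : ℕ) : Monotone (divisionPoint a b N) := by
  intro i j hij
  have := sub_nonneg.2 hab
  unfold divisionPoint
  gcongr

theorem divisionPoint_mem {a b : ℝ} (hab : a ≤ b) {N : ℕ} (hN : N ≠ 0) (i : ℕ) :
    divisionPoint a b N i ∈ Icc a b := by
  have h0 : (0 : ℝ) < N := by positivity
  have h1 : (((min i N : ℕ) : ℝ) / N) ≤ 1 := (div_le_one h0).2 (by exact_mod_cast min_le_right i N)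
  have h2 : (0 : ℝ) ≤ (((min i N : ℕ) : ℝ) / N) := by positivity
  constructor <;> unfold divisionPoint <;> nlinarith

theorem divisionPoint_succ_sub {a b : ℝ} {N i : ℕ} (hi : i < N) :
    divisionPoint a b N (i + 1) - divisionPoint a b N i = (b - a) / N := by
  unfold divisionPoint
  rw [min_eq_left hi.le, min_eq_left (Nat.succ_le_of_lt hi)]
  push_cast
  ring

/-- An inequality `d ≤ M * e` along short pieces of a curve gives an inequality between the distance
of its endpoints and its length. -/
theorem IsDistanceOn.le_mul_curveLength {X : Type*} {d e : X → X → ℝ} (hd : IsDistanceOn univ d)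
    {M ρ a b : ℝ} (hM : 0 ≤ M) (hρ : 0 < ρ) (hab : a ≤ b) {c : ℝ → X}
    (h : ∀ s ∈ Icc a b, ∀ t ∈ Icc a b, dist s t ≤ ρ → d (c s) (c t) ≤ M * e (c s) (c t)) :
    ENNReal.ofReal (d (c a) (c b)) ≤ ENNReal.ofReal M * curveLength e c (Icc a b) := by
  obtain ⟨N, hN⟩ := exists_nat_gt ((b - a) / ρ)
  have hN0 : (0 : ℝ) < N := (div_nonneg (sub_nonneg.2 hab) hρ.le).trans_lt hN
  have hN1 : N ≠ 0 := by rintro rfl; simp at hN0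
  have hmem := divisionPoint_mem hab hN1
  have hsum := hd.le_sum_range (fun i => c (divisionPoint a b N i)) N
  simp only [divisionPoint_zero, divisionPoint_self a b hN1] at hsum
  calc ENNReal.ofReal (d (c a) (c b))
      ≤ ∑ i ∈ Finset.range N, ENNReal.ofReal
          (d (c (divisionPoint a b N i)) (c (divisionPoint a b N (i + 1)))) := by
        rw [← ENNReal.ofReal_sum_of_nonneg fun i _ => hd.nonneg _ trivial _ trivial]
        exact ENNReal.ofReal_le_ofReal hsum
    _ ≤ ∑ i ∈ Finset.range N, ENNReal.ofReal M * ENNReal.ofReal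
          (e (c (divisionPoint a b N i)) (c (divisionPoint a b N (i + 1)))) := by
        refine Finset.sum_le_sum fun i hi => ?_
        rw [← ENNReal.ofReal_mul hM]
        refine ENNReal.ofReal_le_ofReal (h _ (hmem i) _ (hmem (i + 1)) ?_)
        rw [dist_comm, Real.dist_eq, divisionPoint_succ_sub (Finset.mem_range.1 hi),
          abs_of_nonneg (div_nonneg (sub_nonneg.2 hab) hN0.le), div_le_iff₀ hN0, mul_comm]
        exact ((div_lt_iff₀ hρ).1 hN).le
    _ ≤ ENNReal.ofReal M * curveLength e c (Icc a b) := by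
        rw [← Finset.mul_sum]
        gcongr
        exact sum_le_curveLength e c N (monotone_divisionPoint hab N) hmem

/-- If `e` is a length distance and `d ≤ M * e` along short pieces of any `e`-Lipschitz curve, then
`d ≤ M * e` everywhere. -/
theorem IsLengthDistance.le_mul {X : Type*} {d e : X → X → ℝ} (he : IsLengthDistance e)
    (hd : IsDistanceOn univ d) {M : ℝ} (hM : 0 < M)
    (h : ∀ (a b : ℝ) (c : ℝ → X), a ≤ b → IsLipCurveOn e c (Icc a b) → ∃ ρ > 0,
      ∀ s ∈ Icc a b, ∀ t ∈ Icc a b, dist s t ≤ ρ → d (c s) (c t) ≤ M * e (c s) (c t))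
    (x y : X) : d x y ≤ M * e x y := by
  have hM0 : ENNReal.ofReal M ≠ 0 := by simpa using hM
  have hlb : ENNReal.ofReal (d x y) / ENNReal.ofReal M ≤ ENNReal.ofReal (e x y) := by
    refine (he.2 x y).2 ?_
    rintro _ ⟨a, b, c, hab, hc, rfl, rfl, rfl⟩
    obtain ⟨ρ, hρ, hc'⟩ := h a b c hab hc
    exact ENNReal.div_le_of_le_mul' (hd.le_mul_curveLength hM.le hρ hab hc')
  rw [ENNReal.div_le_iff_le_mul (.inl hM0) (.inl ENNReal.ofReal_ne_top), mul_comm,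
    ← ENNReal.ofReal_mul hM.le] at hlb
  exact (ENNReal.ofReal_le_ofReal_iff
    (mul_nonneg hM.le (he.1.nonneg x trivial y trivial))).1 hlb

/-- In a metric space with a length distance, the compactness of all closed balls of some fixed
radius implies the compactness of all closed balls. -/
theorem properSpace_of_isLengthDistance {X : Type*} [MetricSpace X]
    (hlen : IsLengthDistance (dist : X → X → ℝ))
    (hcomp : ∀ x : X, IsCompact (Metric.closedBall x 3)) : ProperSpace X := by
  have step : ∀ (x : X) (n : ℕ), IsCompact (Metric.closedBall x (n : ℝ)) := by
    intro x n
    induction n with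
    | zero => simp
    | succ n ih =>
      obtain ⟨T, -, hcov⟩ := ih.elim_nhds_subcover (fun y => Metric.ball y 1)
        (fun y _ => Metric.ball_mem_nhds y one_pos)
      refine (T.finite_toSet.isCompact_biUnion fun y _ => hcomp y).of_isClosed_subset
        Metric.isClosed_closedBall fun z hz => ?_
      -- a point `w` at distance at most `n` from `x` and at distance less than `2` from `z`
      obtain ⟨w, hw, hwz⟩ : ∃ w, dist w x ≤ n ∧ dist z w < 2 := by
        by_cases hzn : dist z x ≤ n
        · exact ⟨z, hzn, by simp⟩
        have hz' : dist x z ≤ n + 1 := by simpa [dist_comm] using hz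
        obtain ⟨_, ⟨a, b, c, hab, ⟨K, hK, hc⟩, rfl, rfl, rfl⟩, hl⟩ :=
          (isGLB_lt_iff (hlen.2 x z)).1
            ((ENNReal.ofReal_lt_ofReal_iff (by positivity)).2
              (show dist x z < n + 2 by linarith))
        have hcont : ContinuousOn c (Icc a b) :=
          (LipschitzOnWith.of_dist_le_mul (K := ⟨K, hK⟩) hc).continuousOn
        obtain ⟨t, ht, htn⟩ : (n : ℝ) ∈ (fun t => dist (c t) (c a)) '' Icc a b :=
          intermediate_value_Icc hab (by fun_prop)
            ⟨by simp, (not_le.1 hzn).le⟩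
        refine ⟨c t, htn.le, ?_⟩
        rw [← hlen.1.curveLength_Icc_add_Icc c ht.1 ht.2] at hl
        have h1 := hlen.1.le_curveLength c (left_mem_Icc.2 ht.1) (right_mem_Icc.2 ht.1)
        have h2 := hlen.1.le_curveLength c (left_mem_Icc.2 ht.2) (right_mem_Icc.2 ht.2)
        have h3 := (add_le_add h1 h2).trans_lt hl
        rw [← ENNReal.ofReal_add dist_nonneg dist_nonneg,
          ENNReal.ofReal_lt_ofReal_iff (by positivity)] at h3
        rw [dist_comm (c b)]
        replace htn : dist (c a) (c t) = n := (dist_comm _ _).trans htn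
        linarith
      obtain ⟨y, hy, hwy⟩ := mem_iUnion₂.1 (hcov hw)
      refine mem_iUnion₂.2 ⟨y, hy, ?_⟩
      have := dist_triangle z w y
      rw [Metric.mem_ball] at hwy
      rw [Metric.mem_closedBall]
      linarith
  refine ⟨fun x r => ?_⟩
  obtain ⟨n, hn⟩ := exists_nat_ge r
  exact (step x n).of_isClosed_subset Metric.isClosed_closedBall
    (Metric.closedBall_subset_closedBall hn)

theorem IsDistanceOn.abs_sub_le {X : Type*} {d : X → X → ℝ} (hd : IsDistanceOn univ d)
    (x y x' y' : X) : |d x y - d x' y'| ≤ d x x' + d y y' := by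
  let := hd.toPseudoMetricSpace
  exact dist_dist_dist_le x y x' y'

theorem IsDistanceOn.continuous_of_le_mul_dist {X : Type*} [MetricSpace X] {d : X → X → ℝ}
    (hd : IsDistanceOn univ d) {M' : ℝ} (hM' : ∀ x y, d x y ≤ M' * dist x y) :
    Continuous fun p : X × X => d p.1 p.2 := by
  refine continuous_iff_continuousAt.2 fun q => tendsto_iff_dist_tendsto_zero.2 ?_
  have hlim : Tendsto (fun p : X × X => M' * dist p.1 q.1 + M' * dist p.2 q.2) (𝓝 q) (𝓝 0) := by
    have : Continuous fun p : X × X => M' * dist p.1 q.1 + M' * dist p.2 q.2 := by fun_prop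
    simpa using this.tendsto q
  exact squeeze_zero (fun _ => dist_nonneg)
    (fun p => (hd.abs_sub_le _ _ _ _).trans (add_le_add (hM' _ _) (hM' _ _))) hlim

/-- If `d` is locally dominated by the metric and the metric is a length distance, then `d` is
dominated by the metric. -/
theorem IsDistanceOn.le_mul_dist {X : Type*} [MetricSpace X] {d : X → X → ℝ}
    (hd : IsDistanceOn univ d) (hlen : IsLengthDistance (dist : X → X → ℝ)) {M' : ℝ}
    (hM' : 0 < M')
    (hloc : ∀ K : Set X, IsCompact K → ∃ η > 0, ∀ u ∈ K, ∀ v ∈ K, dist u v ≤ η →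
      d u v ≤ M' * dist u v) (x y : X) : d x y ≤ M' * dist x y := by
  refine hlen.le_mul hd hM' (fun a b c hab ⟨L, hL, hc⟩ => ?_) x y
  have hcont : ContinuousOn c (Icc a b) :=
    (LipschitzOnWith.of_dist_le_mul (K := ⟨L, hL⟩) hc).continuousOn
  obtain ⟨η, hη, h⟩ := hloc _ (isCompact_Icc.image_of_continuousOn hcont)
  have hL1 : 0 < L + 1 := by positivity
  refine ⟨η / (L + 1), by positivity, fun s hs t ht hst =>
    h _ (mem_image_of_mem c hs) _ (mem_image_of_mem c ht) ?_⟩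
  have h1 := (le_div_iff₀ hL1).1 hst
  have h2 := hc s hs t ht
  have h3 : 0 ≤ dist s t := dist_nonneg
  linarith

/-! ### Continuity of the curves which are Lipschitz for another distance -/

section

variable {X : Type*} [MetricSpace X] {d : X → X → ℝ} {M M' L a b : ℝ} {c : ℝ → X}

/-- On compact sets, smallness for the metric may be replaced by smallness for `d`. -/
theorem IsDistanceOn.dist_le_mul_of_lt (hd : IsDistanceOn univ d)
    (hM' : ∀ x y, d x y ≤ M' * dist x y) {K : Set X} (hK : IsCompact K)
    (hloc : ∃ η > 0, ∀ u ∈ K, ∀ v ∈ K, dist u v ≤ η → dist u v ≤ M * d u v) :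
    ∃ η > 0, ∀ u ∈ K, ∀ v ∈ K, d u v < η → dist u v ≤ M * d u v := by
  obtain ⟨η, hη, h⟩ := hloc
  set S : Set (X × X) := (K ×ˢ K) ∩ {p | η ≤ dist p.1 p.2}
  have hS : IsCompact S :=
    (hK.prod hK).inter_right (isClosed_le continuous_const continuous_dist)
  have hmem : ∀ u ∈ K, ∀ v ∈ K, η < dist u v → (u, v) ∈ S := fun u hu v hv huv =>
    ⟨⟨hu, hv⟩, huv.le⟩
  rcases S.eq_empty_or_nonempty with hE | hE
  · refine ⟨1, one_pos, fun u hu v hv _ => h u hu v hv ?_⟩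
    by_contra! hlt
    exact notMem_empty _ (hE ▸ hmem u hu v hv hlt)
  · obtain ⟨⟨p, q⟩, ⟨-, hpq⟩, hmin⟩ :=
      hS.exists_isMinOn hE (hd.continuous_of_le_mul_dist hM').continuousOn
    refine ⟨d p q, (hd.nonneg p trivial q trivial).lt_of_ne fun h0 => ?_,
      fun u hu v hv huv => h u hu v hv ?_⟩
    · obtain rfl := (hd.eq_zero_iff p trivial q trivial).1 h0.symm
      simp only [mem_ofPred_eq, dist_self] at hpq
      linarith
    · by_contra! hlt
      exact huv.not_ge (hmin (hmem u hu v hv hlt))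

variable [ProperSpace X]

theorem IsDistanceOn.exists_dist_le_mul_of_isBounded (hd : IsDistanceOn univ d)
    (hM' : ∀ x y, d x y ≤ M' * dist x y)
    (hloc : ∀ K : Set X, IsCompact K → ∃ η > 0, ∀ u ∈ K, ∀ v ∈ K, dist u v ≤ η →
      dist u v ≤ M * d u v)
    (hL : 0 ≤ L) {s : Set ℝ} (hc : ∀ p ∈ s, ∀ q ∈ s, d (c p) (c q) ≤ L * dist p q)
    (hb : Bornology.IsBounded (c '' s)) :
    ∃ ρ > 0, ∀ p ∈ s, ∀ q ∈ s, dist p q ≤ ρ → dist (c p) (c q) ≤ M * d (c p) (c q) := by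
  have hK := hb.isCompact_closure
  obtain ⟨η, hη, h⟩ := hd.dist_le_mul_of_lt hM' hK (hloc _ hK)
  have hL1 : 0 < L + 1 := by positivity
  refine ⟨η / (L + 1) / 2, by positivity, fun p hp q hq hpq =>
    h _ (subset_closure (mem_image_of_mem c hp)) _ (subset_closure (mem_image_of_mem c hq)) ?_⟩
  have h1 := hc p hp q hq
  have h2 : dist p q * (L + 1) ≤ η / 2 := by
    rw [div_right_comm] at hpq
    exact (le_div_iff₀ hL1).1 hpq
  have h3 : 0 ≤ dist p q := dist_nonneg
  linarith

theorem IsDistanceOn.dist_le_of_isBounded_uIcc (hd : IsDistanceOn univ d)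
    (hdist : IsDistanceOn univ (dist : X → X → ℝ)) (hM : 0 ≤ M)
    (hM' : ∀ x y, d x y ≤ M' * dist x y)
    (hloc : ∀ K : Set X, IsCompact K → ∃ η > 0, ∀ u ∈ K, ∀ v ∈ K, dist u v ≤ η →
      dist u v ≤ M * d u v)
    (hL : 0 ≤ L) (hc : ∀ p ∈ Icc a b, ∀ q ∈ Icc a b, d (c p) (c q) ≤ L * dist p q)
    {p q : ℝ} (hp : p ∈ Icc a b) (hq : q ∈ Icc a b) (hb : Bornology.IsBounded (c '' uIcc p q)) :
    dist (c p) (c q) ≤ M * (L * dist p q) := by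
  wlog hpq : p ≤ q generalizing p q
  · rw [dist_comm (c p), dist_comm p]
    exact this hq hp (by rwa [uIcc_comm]) (not_le.1 hpq).le
  rw [uIcc_of_le hpq] at hb
  have hc' : ∀ s ∈ Icc p q, ∀ t ∈ Icc p q, d (c s) (c t) ≤ L * dist s t := fun s hs t ht =>
    hc s (Icc_subset_Icc hp.1 hq.2 hs) t (Icc_subset_Icc hp.1 hq.2 ht)
  obtain ⟨ρ, hρ, h⟩ := hd.exists_dist_le_mul_of_isBounded hM' hloc hL hc' hb
  have h1 := hdist.le_mul_curveLength hM hρ hpq h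
  have h2 := h1.trans (mul_le_mul_right (curveLength_le_of_lipschitz hL hc') _)
  have h3 := mul_nonneg hL (sub_nonneg.2 hpq)
  rw [← ENNReal.ofReal_mul hM, ENNReal.ofReal_le_ofReal_iff (mul_nonneg hM h3)] at h2
  rwa [dist_comm p, Real.dist_eq, abs_of_nonneg (sub_nonneg.2 hpq)]

/-- A `d`-Lipschitz curve has a closed preimage of any closed ball, since balls are compact and
convergence in the metric implies convergence for `d`. -/
theorem IsDistanceOn.isClosed_preimage_closedBall (hd : IsDistanceOn univ d)
    (hM' : ∀ x y, d x y ≤ M' * dist x y) {α : Type*} [PseudoMetricSpace α] {c : α → X}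
    (hc : ∀ p q, d (c p) (c q) ≤ L * dist p q) (x : X) (r : ℝ) :
    IsClosed (c ⁻¹' Metric.closedBall x r) := by
  refine IsSeqClosed.isClosed fun u p hu hup => ?_
  obtain ⟨y, hy, φ, hφ, hlim⟩ := (isCompact_closedBall x r).tendsto_subseq hu
  have h0 : Tendsto (fun n => L * dist p (u (φ n)) + M' * dist (c (u (φ n))) y) atTop (𝓝 0) := by
    have h1 := (tendsto_const_nhds (x := p)).dist (hup.comp hφ.tendsto_atTop)
    have h2 := hlim.dist (tendsto_const_nhds (x := y))
    simpa using (h1.const_mul L).add (h2.const_mul M')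
  have hle : d (c p) y ≤ 0 := ge_of_tendsto' h0 fun n =>
    (hd.triangle _ trivial (c (u (φ n))) trivial _ trivial).trans
      (add_le_add (hc _ _) (hM' _ _))
  have : c p = y := (hd.eq_zero_iff _ trivial _ trivial).1
    (hle.antisymm (hd.nonneg _ trivial _ trivial))
  rwa [mem_preimage, this]

/-- A `d`-Lipschitz curve is bounded in the metric. By Baire's theorem, the closed set `E` of
parameters near which it is unbounded would have a nonempty relatively open part on which the curve
is bounded; every other nearby parameter `t` is separated from the nearest point of `E` by an
interval on which the curve is Lipschitz in the metric. -/
theorem IsDistanceOn.isBounded_image (hd : IsDistanceOn univ d)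
    (hdist : IsDistanceOn univ (dist : X → X → ℝ)) (hM : 0 ≤ M)
    (hM' : ∀ x y, d x y ≤ M' * dist x y)
    (hloc : ∀ K : Set X, IsCompact K → ∃ η > 0, ∀ u ∈ K, ∀ v ∈ K, dist u v ≤ η →
      dist u v ≤ M * d u v)
    (hL : 0 ≤ L) (hc : ∀ p ∈ Icc a b, ∀ q ∈ Icc a b, d (c p) (c q) ≤ L * dist p q) :
    Bornology.IsBounded (c '' Icc a b) := by
  set E : Set ℝ := {t | t ∈ Icc a b ∧ ∀ V ∈ 𝓝[Icc a b] t, ¬ Bornology.IsBounded (c '' V)} with hE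
  have hEcl : IsClosed E := by
    refine isClosed_of_closure_subset fun x hx => ⟨?_, fun V hV hVb => ?_⟩
    · exact isClosed_Icc.closure_subset_iff.2 (fun t ht => ht.1) hx
    · obtain ⟨O, hO, hxO, hOV⟩ := mem_nhdsWithin.1 hV
      obtain ⟨t, htO, ht⟩ := mem_closure_iff.1 hx O hO hxO
      exact ht.2 (O ∩ Icc a b) (inter_comm O _ ▸ inter_mem_nhdsWithin _ (hO.mem_nhds htO))
        (hVb.subset (image_mono hOV))
  have hbdd : ∀ s ⊆ Icc a b, IsCompact s → Disjoint s E → Bornology.IsBounded (c '' s) := by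
    intro s hs hcomp hdisj
    refine hcomp.induction_on (p := fun s => Bornology.IsBounded (c '' s)) (by simp)
      (fun s t hst ht => ht.subset (image_mono hst))
      (fun s t hs' ht' => by rw [image_union]; exact hs'.union ht') fun x hx => ?_
    have hxE : x ∉ E := disjoint_left.1 hdisj hx
    simp only [hE, mem_ofPred_eq, not_and, not_forall, not_not] at hxE
    obtain ⟨V, hV, hVb⟩ := hxE (hs hx)
    exact ⟨V, nhdsWithin_mono x hs hV, hVb⟩
  rcases E.eq_empty_or_nonempty with hE0 | hEne
  · exact hbdd _ subset_rfl isCompact_Icc (by simp [hE0])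
  exfalso
  have hlip : ∀ p ∈ Icc a b, ∀ q ∈ Icc a b, Bornology.IsBounded (c '' uIcc p q) →
      dist (c p) (c q) ≤ M * (L * dist p q) := fun p hp q hq =>
    hd.dist_le_of_isBounded_uIcc hdist hM hM' hloc hL hc hp hq
  have hML : ∀ p ∈ Icc a b, ∀ q ∈ Icc a b, M * (L * dist p q) ≤ M * (L * (b - a)) := by
    intro p hp q hq
    have := Real.dist_le_of_mem_Icc hp hq
    gcongr
  -- the estimate extends to an endpoint belonging to `E`, one additional point being bounded
  have hgap : ∀ α ∈ Icc a b, ∀ t ∈ Icc a b, (∀ x ∈ uIcc α t, x ≠ α → x ∉ E) →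
      dist (c α) (c t) ≤ M * (L * (b - a)) := by
    intro α hα t ht hfree
    refine (hlip α hα t ht ?_).trans (hML α hα t ht)
    refine ((Metric.isBounded_closedBall (x := c t) (r := M * (L * (b - a)))).union
      (Bornology.isBounded_singleton (x := c α))).subset ?_
    rintro _ ⟨q, hq, rfl⟩
    by_cases hqα : q = α
    · exact .inr (by rw [hqα]; rfl)
    have hqI : q ∈ Icc a b := uIcc_subset_Icc hα ht hq
    refine .inl ((hlip q hqI t ht (hbdd _ (uIcc_subset_Icc hqI ht) isCompact_uIcc
      (disjoint_left.2 fun x hx => hfree x (uIcc_subset_uIcc_right hq hx) ?_))).trans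
      (hML q hqI t ht))
    rintro rfl
    rw [mem_uIcc] at hx hq
    exact hqα (by rcases hx with hx | hx <;> rcases hq with hq | hq <;> linarith)
  have : CompleteSpace E := hEcl.isComplete.completeSpace_coe
  have : Nonempty E := hEne.to_subtype
  obtain ⟨m, ⟨e, he⟩, hem⟩ := nonempty_interior_of_iUnion_of_closed
    (f := fun m : ℕ => (fun x : E => c x) ⁻¹' Metric.closedBall (c a) m)
    (fun m => hd.isClosed_preimage_closedBall hM' (fun p q : E => hc p p.2.1 q q.2.1) (c a) m)
    (iUnion_eq_univ_iff.2 fun x => exists_nat_ge (dist (c x) (c a)))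
  obtain ⟨δ, hδ, hball⟩ := Metric.mem_nhds_iff.1 (mem_interior_iff_mem_nhds.1 hem)
  refine he.2 _ (inter_mem_nhdsWithin _ (Metric.ball_mem_nhds e hδ)) ?_
  refine (Metric.isBounded_closedBall (x := c a) (r := M * (L * (b - a)) + m)).subset ?_
  rintro _ ⟨t, ⟨ht, hte⟩, rfl⟩
  obtain ⟨α, ⟨hαE, hα⟩, hmin⟩ := (isCompact_uIcc.inter_left hEcl).exists_isMinOn
    ⟨e, he, left_mem_uIcc (b := t)⟩ (f := fun x => dist x t) (by fun_prop)
  have h1 : dist (c α) (c t) ≤ M * (L * (b - a)) := by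
    refine hgap α hαE.1 t ht fun x hx hxα hxE => hxα ?_
    have h2 : dist α t ≤ dist x t := hmin ⟨hxE, uIcc_subset_uIcc_right hα hx⟩
    rw [Real.dist_eq, Real.dist_eq] at h2
    rw [mem_uIcc] at hx
    rcases hx with hx | hx
    · rw [abs_of_nonpos (by linarith), abs_of_nonpos (by linarith)] at h2
      linarith
    · rw [abs_of_nonneg (by linarith), abs_of_nonneg (by linarith)] at h2
      linarith
  have h2 : dist (c α) (c a) ≤ m := by
    have h3 : |α - e| ≤ |t - e| := abs_sub_left_of_mem_uIcc hα
    exact hball (a := ⟨α, hαE⟩) (h3.trans_lt hte)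
  have h3 := dist_triangle_left (c t) (c a) (c α)
  rw [Metric.mem_closedBall]
  linarith

/-- If the metric is locally dominated by the length distance `d`, then it is dominated by `d`. -/
theorem IsLengthDistance.dist_le_mul (hd : IsLengthDistance d)
    (hdist : IsDistanceOn univ (dist : X → X → ℝ)) (hM : 0 < M)
    (hM' : ∀ x y, d x y ≤ M' * dist x y)
    (hloc : ∀ K : Set X, IsCompact K → ∃ η > 0, ∀ u ∈ K, ∀ v ∈ K, dist u v ≤ η →
      dist u v ≤ M * d u v) (x y : X) : dist x y ≤ M * d x y :=
  hd.le_mul hdist hM (fun _ _ _ _ ⟨_, hL, hc⟩ =>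
    hd.1.exists_dist_le_mul_of_isBounded hM' hloc hL hc
      (hd.1.isBounded_image hdist hM.le hM' hloc hL hc)) x y

end

/-! ### Concatenation of short curves -/

/-- Points at distance less than `ℓ` are joined by a Lipschitz curve of length at most `ℓ`,
parametrized by `[0, 1]`. -/
theorem IsLengthDistance.exists_curve {X : Type*} {d : X → X → ℝ} (hd : IsLengthDistance d)
    {x y : X} {ℓ : ℝ} (h : d x y < ℓ) :
    ∃ c : ℝ → X, IsLipCurveOn d c (Icc 0 1) ∧ c 0 = x ∧ c 1 = y ∧
      curveLength d c (Icc 0 1) ≤ ENNReal.ofReal ℓ := by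
  obtain ⟨_, ⟨a, b, c, hab, ⟨K, hK, hc⟩, rfl, rfl, rfl⟩, hl⟩ := (isGLB_lt_iff (hd.2 x y)).1
    ((ENNReal.ofReal_lt_ofReal_iff ((hd.1.nonneg x trivial y trivial).trans_lt h)).2 h)
  have hba := sub_nonneg.2 hab
  set φ : ℝ → ℝ := fun s => a + (b - a) * s with hφ
  have hmono : Monotone φ := fun s t hst => by
    simp only [hφ]
    gcongr
  have hmaps : MapsTo φ (Icc 0 1) (Icc a b) := fun s hs => by
    constructor <;> simp only [hφ] <;> nlinarith [hs.1, hs.2]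
  refine ⟨c ∘ φ, ⟨K * (b - a), mul_nonneg hK hba, fun s hs t ht => ?_⟩, by simp [hφ], by simp [hφ],
    (curveLength_comp_le d c hmono hmaps).trans hl.le⟩
  refine (hc _ (hmaps hs) _ (hmaps ht)).trans_eq ?_
  simp only [hφ, Real.dist_eq]
  rw [add_sub_add_left_eq_sub, ← mul_sub, abs_mul, abs_of_nonneg hba, mul_assoc]

theorem IsDistanceOn.isLipCurveOn_Icc_union {X : Type*} {d : X → X → ℝ}
    (hd : IsDistanceOn univ d) {c : ℝ → X} {p q r : ℝ} (h₁ : IsLipCurveOn d c (Icc p q))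
    (h₂ : IsLipCurveOn d c (Icc q r)) : IsLipCurveOn d c (Icc p r) := by
  obtain ⟨K₁, hK₁, h₁⟩ := h₁
  obtain ⟨K₂, hK₂, h₂⟩ := h₂
  refine ⟨K₁ + K₂, by positivity, fun s hs t ht => ?_⟩
  wlog hst : s ≤ t generalizing s t
  · rw [hd.symm _ trivial _ trivial, dist_comm]
    exact this t ht s hs (not_le.1 hst).le
  have h0 : 0 ≤ dist s t := dist_nonneg
  rcases le_total t q with htq | hqt
  · nlinarith [h₁ s ⟨hs.1, hst.trans htq⟩ t ⟨ht.1, htq⟩]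
  rcases le_total s q with hsq | hqs
  · have h3 := h₁ s ⟨hs.1, hsq⟩ q ⟨hs.1.trans hsq, le_rfl⟩
    have h4 := h₂ q ⟨le_rfl, hqt.trans ht.2⟩ t ⟨hqt, ht.2⟩
    have h5 := hd.triangle (c s) trivial (c q) trivial (c t) trivial
    rw [dist_comm, Real.dist_eq, abs_of_nonneg (by linarith)] at h3 h4 ⊢
    nlinarith
  · nlinarith [h₂ s ⟨hqs, hs.2⟩ t ⟨hqt, ht.2⟩]

/-- Consecutive points of a sequence are joined by short curves, parametrized by the intervals
`[i, i + 1]`. -/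
theorem IsLengthDistance.exists_chain {X : Type*} {d : X → X → ℝ} (hd : IsLengthDistance d)
    (x : ℕ → X) (ℓ : ℕ → ℝ) (hℓ : ∀ i, d (x i) (x (i + 1)) < ℓ i) (n : ℕ) :
    ∃ c : ℝ → X, IsLipCurveOn d c (Icc 0 n) ∧ c n = x n ∧
      curveLength d c (Icc 0 n) ≤ ∑ i ∈ Finset.range n, ENNReal.ofReal (ℓ i) ∧
      ∀ i : ℕ, i < n → ∀ s ∈ Icc (i : ℝ) (i + 1), d (x i) (c s) ≤ ℓ i := by
  induction n with
  | zero =>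
    have h0 : d (x 0) (x 0) = 0 := (hd.1.eq_zero_iff _ trivial _ trivial).2 rfl
    refine ⟨fun _ => x 0, ⟨0, le_rfl, fun s _ t _ => by simp [h0]⟩, rfl, ?_, by simp⟩
    simp [curveLength, h0]
  | succ n ih =>
    obtain ⟨c, hc, hcn, hlen, hnear⟩ := ih
    obtain ⟨σ, ⟨K, hK, hσ⟩, hσ0, hσ1, hσlen⟩ := hd.exists_curve (hℓ n)
    have hn0 : (0 : ℝ) ≤ n := n.cast_nonneg
    set γ : ℝ → X := fun s => if s ≤ n then c s else σ (s - n) with hγ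
    have hγ1 : EqOn γ c (Icc 0 n) := fun s hs => if_pos hs.2
    have hγ2 : EqOn γ (σ ∘ fun s => s - n) (Icc n (n + 1)) := fun s hs => by
      rcases hs.1.eq_or_lt with rfl | hlt
      · simp [hγ, hcn, hσ0]
      · exact if_neg hlt.not_ge
    have hmaps : MapsTo (fun s : ℝ => s - n) (Icc n (n + 1)) (Icc 0 1) := fun s hs =>
      ⟨sub_nonneg.2 hs.1, by linarith [hs.2]⟩
    have hmono : Monotone fun s : ℝ => s - n := fun s t hst => sub_le_sub_right hst _
    have hlen2 : curveLength d γ (Icc n (n + 1)) ≤ ENNReal.ofReal (ℓ n) := by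
      rw [curveLength_congr d hγ2]
      exact (curveLength_comp_le d σ hmono hmaps).trans hσlen
    push_cast
    refine ⟨γ, hd.1.isLipCurveOn_Icc_union (q := n) ?_ ?_, ?_, ?_, fun i hi s hs => ?_⟩
    · obtain ⟨K', hK', hc⟩ := hc
      exact ⟨K', hK', fun s hs t ht => by rw [hγ1 hs, hγ1 ht]; exact hc s hs t ht⟩
    · refine ⟨K, hK, fun s hs t ht => ?_⟩
      rw [hγ2 hs, hγ2 ht]
      simpa [Real.dist_eq] using hσ _ (hmaps hs) _ (hmaps ht)
    · rw [hγ2 (right_mem_Icc.2 (by linarith))]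
      simp [hσ1]
    · rw [← hd.1.curveLength_Icc_add_Icc γ hn0 (by linarith : (n : ℝ) ≤ n + 1),
        Finset.sum_range_succ, curveLength_congr d hγ1]
      exact add_le_add hlen hlen2
    · rcases (Nat.lt_succ_iff.1 hi).eq_or_lt with rfl | hin
      · have h1 : γ i = x i := (hγ1 (right_mem_Icc.2 hn0)).trans hcn
        have h2 := (hd.1.le_curveLength γ (left_mem_Icc.2 (hs.1.trans hs.2)) hs).trans hlen2
        rw [h1] at h2
        exact (ENNReal.ofReal_le_ofReal_iff
          ((hd.1.nonneg _ trivial _ trivial).trans (hℓ i).le)).1 h2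
      · have hin' : (i : ℝ) + 1 ≤ n := by exact_mod_cast hin
        rw [hγ1 ⟨i.cast_nonneg.trans hs.1, hs.2.trans hin'⟩]
        exact hnear i hin s hs

/-- The point `i / N` of the unit interval, replaced by `1` for `i > N`. -/
noncomputable def unitDivision (N i : ℕ) : unitInterval := projIcc 0 1 zero_le_one ((i : ℝ) / N)

theorem monotone_unitDivision (N : ℕ) : Monotone (unitDivision N) := fun i j hij =>
  monotone_projIcc _ (by gcongr)

theorem coe_unitDivision {N i : ℕ} (hi : i ≤ N) : (unitDivision N i : ℝ) = (i : ℝ) / N := by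
  rw [unitDivision, projIcc_of_mem zero_le_one ⟨by positivity, ?_⟩]
  exact div_le_one_of_le₀ (by exact_mod_cast hi) (by positivity)

section

variable {X : Type*} [MetricSpace X] {d : X → X → ℝ} {M M' K : ℝ}

/-- Replacing the pieces of a Lipschitz curve over the intervals `[i / N, (i + 1) / N]` by nearly
`d`-shortest curves moves it by `O(1 / N)`, with a constant depending on `d` only through the
comparison with the metric. -/
theorem IsLengthDistance.exists_lipCurve_near (hd : IsLengthDistance d) (hM : 0 ≤ M) (hM' : 0 ≤ M')
    (hK : 0 ≤ K) (h : ∀ x y, dist x y ≤ M * d x y) (h' : ∀ x y, d x y ≤ M' * dist x y)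
    (c : C(unitInterval, X)) (hc : ∀ s t, dist (c s) (c t) ≤ K * dist s t) {N : ℕ} (hN : 0 < N) :
    ∃ γ ∈ lipCurves d, dist γ c ≤ (M * (M' * K + 1) + K) / N ∧
      lengthFunctional d γ ≤ ∑ i ∈ Finset.range N, ENNReal.ofReal
        (d (c (unitDivision N i)) (c (unitDivision N (i + 1)))) + ENNReal.ofReal (1 / N) := by
  have hN0 : (0 : ℝ) < N := by exact_mod_cast hN
  have hN1 : (1 : ℝ) ≤ N := by exact_mod_cast hN
  set x : ℕ → X := fun i => c (unitDivision N i) with hx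
  -- the surplus `1 / N ^ 2` allowed for each of the `N` pieces adds up to `1 / N`
  obtain ⟨σ, ⟨L, hL, hσ⟩, -, hlen, hnear⟩ := hd.exists_chain x
    (fun i => d (x i) (x (i + 1)) + 1 / N ^ 2) (fun i => lt_add_of_pos_right _ (by positivity)) N
  set φ : unitInterval → ℝ := fun s => N * (s : ℝ) with hφ
  have hmono : Monotone φ := fun s t hst => mul_le_mul_of_nonneg_left hst hN0.le
  have hmaps : MapsTo φ univ (Icc 0 N) := fun s _ =>
    ⟨mul_nonneg hN0.le s.2.1, mul_le_of_le_one_right hN0.le s.2.2⟩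
  have hlipd : ∀ s t, d (σ (φ s)) (σ (φ t)) ≤ L * N * dist s t := fun s t => by
    refine (hσ _ (hmaps trivial) _ (hmaps trivial)).trans_eq ?_
    rw [Real.dist_eq, ← mul_sub, abs_mul, abs_of_pos hN0, mul_assoc]
    rfl
  have hcont : Continuous (σ ∘ φ) := by
    refine (LipschitzWith.of_dist_le_mul (K := ⟨M * (L * N), by positivity⟩)
      fun s t => ?_).continuous
    refine (h _ _).trans ?_
    change _ ≤ M * (L * N) * dist s t
    rw [mul_assoc]
    exact mul_le_mul_of_nonneg_left (hlipd s t) hM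
  refine ⟨⟨σ ∘ φ, hcont⟩, ⟨L * N, by positivity, fun s _ t _ => hlipd s t⟩, ?_, ?_⟩
  · refine (ContinuousMap.dist_le (by positivity)).2 fun s => ?_
    obtain ⟨i, hi, hsi, hsi'⟩ : ∃ i < N, (i : ℝ) ≤ N * s ∧ N * (s : ℝ) ≤ i + 1 := by
      rcases s.2.2.eq_or_lt with h1 | h1
      · refine ⟨N - 1, by omega, ?_, ?_⟩ <;> rw [h1, Nat.cast_pred hN] <;> linarith
      · have h0 : 0 ≤ N * (s : ℝ) := mul_nonneg hN0.le s.2.1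
        refine ⟨⌊N * (s : ℝ)⌋₊, (Nat.floor_lt h0).2 (mul_lt_of_lt_one_right hN0 h1),
          Nat.floor_le h0, (Nat.lt_floor_add_one _).le⟩
    have h1 : dist (x i) (σ (φ s)) ≤ M * ((M' * K + 1) / N) := by
      refine (h _ _).trans (mul_le_mul_of_nonneg_left
        ((hnear i hi (φ s) ⟨hsi, hsi'⟩).trans ?_) hM)
      have h2 : dist (unitDivision N i) (unitDivision N (i + 1)) = 1 / N := by
        rw [dist_comm, Subtype.dist_eq, coe_unitDivision hi.le, coe_unitDivision hi, Real.dist_eq,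
          ← sub_div, Nat.cast_succ, add_sub_cancel_left, abs_of_pos (by positivity)]
      have h3 := (h' (x i) (x (i + 1))).trans (mul_le_mul_of_nonneg_left (hc _ _) hM')
      rw [h2] at h3
      have h4 : (1 : ℝ) / N ^ 2 ≤ 1 / N :=
        one_div_le_one_div_of_le hN0 (le_self_pow₀ hN1 two_ne_zero)
      calc _ ≤ M' * (K * (1 / N)) + 1 / N := add_le_add h3 h4
        _ = _ := by ring
    have h2 : dist (x i) (c s) ≤ K * (1 / N) := by
      refine (hc _ _).trans (mul_le_mul_of_nonneg_left ?_ hK)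
      rw [dist_comm, Subtype.dist_eq, coe_unitDivision hi.le, Real.dist_eq, abs_le]
      constructor
      · have : (i : ℝ) / N ≤ s := (div_le_iff₀' hN0).2 hsi
        linarith [one_div_pos.2 hN0]
      · have : (s : ℝ) ≤ (i + 1) / N := (le_div_iff₀' hN0).2 hsi'
        rw [add_div] at this
        linarith
    calc dist (σ (φ s)) (c s) ≤ dist (x i) (σ (φ s)) + dist (x i) (c s) := dist_triangle_left _ _ _
      _ ≤ M * ((M' * K + 1) / N) + K * (1 / N) := add_le_add h1 h2
      _ = _ := by ring
  · refine ((curveLength_comp_le d σ hmono hmaps).trans hlen).trans_eq ?_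
    have h1 : ∀ i ∈ Finset.range N, ENNReal.ofReal (d (x i) (x (i + 1)) + 1 / N ^ 2) =
        ENNReal.ofReal (d (x i) (x (i + 1))) + ENNReal.ofReal (1 / N ^ 2) := fun i _ =>
      ENNReal.ofReal_add (hd.1.nonneg _ trivial _ trivial) (by positivity)
    rw [Finset.sum_congr rfl h1, Finset.sum_add_distrib, Finset.sum_const, Finset.card_range,
      ← ENNReal.ofReal_nsmul, nsmul_eq_mul]
    congr 2
    field_simp

/-! ### Gamma-convergence -/

/-- If the infima of nonnegative functionals tend to zero, then suitable points realize this. -/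
theorem exists_tendsto_zero_of_eventually_exists_le {Y : Type*} {Z : ℕ → Set Y}
    (hZ : ∀ n, (Z n).Nonempty) (Φ : ℕ → Y → ℝ≥0∞)
    (h : ∀ ε : ℝ≥0∞, 0 < ε → ∀ᶠ n in atTop, ∃ y ∈ Z n, Φ n y ≤ ε) :
    ∃ y : ℕ → Y, (∀ n, y n ∈ Z n) ∧ Tendsto (fun n => Φ n (y n)) atTop (𝓝 0) := by
  have hex : ∀ n : ℕ, ∃ y ∈ Z n, Φ n y ≤ (⨅ y ∈ Z n, Φ n y) + (n : ℝ≥0∞)⁻¹ := by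
    intro n
    by_cases htop : (⨅ y ∈ Z n, Φ n y) = ∞
    · obtain ⟨y, hy⟩ := hZ n
      exact ⟨y, hy, by simp [htop]⟩
    · have hlt : (⨅ y ∈ Z n, Φ n y) < (⨅ y ∈ Z n, Φ n y) + (n : ℝ≥0∞)⁻¹ :=
        ENNReal.lt_add_right htop (ENNReal.inv_ne_zero.2 (ENNReal.natCast_ne_top n))
      simp only [iInf_lt_iff] at hlt
      obtain ⟨y, hy, hyl⟩ := hlt
      exact ⟨y, hy, hyl.le⟩
  choose y hyZ hy using hex
  have hinf : Tendsto (fun n => ⨅ y ∈ Z n, Φ n y) atTop (𝓝 0) :=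
    ENNReal.tendsto_nhds_zero.2 fun ε hε => (h ε hε).mono fun n ⟨y, hyn, hyε⟩ =>
      (iInf₂_le y hyn).trans hyε
  refine ⟨y, hyZ, tendsto_of_tendsto_of_tendsto_of_le_of_le tendsto_const_nhds ?_
    (fun _ => zero_le) hy⟩
  simpa using hinf.add ENNReal.tendsto_inv_nat_nhds_zero

theorem lengthFunctional_le_liminf {d : ℕ → X → X → ℝ} {d₀ : X → X → ℝ}
    (hd : ∀ n, IsDistanceOn univ (d n)) (h' : ∀ n x y, d n x y ≤ M' * dist x y)
    (hlim : ∀ x y, Tendsto (fun n => d n x y) atTop (𝓝 (d₀ x y)))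
    {c : ℕ → C(unitInterval, X)} {c₀ : C(unitInterval, X)} (hc : Tendsto c atTop (𝓝 c₀)) :
    lengthFunctional d₀ c₀ ≤ liminf (fun n => lengthFunctional (d n) (c n)) atTop := by
  have hpt : ∀ s t, Tendsto (fun n => d n (c n s) (c n t)) atTop (𝓝 (d₀ (c₀ s) (c₀ t))) := by
    intro s t
    have heval : ∀ s, Tendsto (fun n => M' * dist (c n s) (c₀ s)) atTop (𝓝 0) := fun s => by
      have h1 : Tendsto (fun n => c n s) atTop (𝓝 (c₀ s)) :=
        ((continuous_eval_const s).tendsto c₀).comp hc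
      simpa using (tendsto_iff_dist_tendsto_zero.1 h1).const_mul M'
    refine tendsto_of_tendsto_of_dist (hlim (c₀ s) (c₀ t)) (squeeze_zero (fun _ => dist_nonneg)
      (fun n => ?_) (by simpa using (heval s).add (heval t)))
    rw [dist_comm]
    exact ((hd n).abs_sub_le _ _ _ _).trans (add_le_add (h' _ _ _) (h' _ _ _))
  refine iSup_le fun ⟨m, t, ht, hts⟩ => ?_
  have hsum : Tendsto (fun n => ∑ i ∈ Finset.range m,
      ENNReal.ofReal (d n (c n (t i)) (c n (t (i + 1))))) atTop
      (𝓝 (∑ i ∈ Finset.range m, ENNReal.ofReal (d₀ (c₀ (t i)) (c₀ (t (i + 1)))))) :=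
    tendsto_finsetSum _ fun i _ => ENNReal.tendsto_ofReal (hpt _ _)
  change ∑ i ∈ Finset.range m, ENNReal.ofReal (d₀ (c₀ (t i)) (c₀ (t (i + 1)))) ≤ _
  rw [← hsum.liminf_eq]
  exact liminf_le_liminf (.of_forall fun n => sum_le_curveLength (d n) (c n) m ht hts)

/-- Length functionals of length distances which are uniformly equivalent to the metric
Gamma-converge if the distances converge pointwise. -/
theorem gammaConverges_lengthFunctional {d : ℕ → X → X → ℝ} {d₀ : X → X → ℝ}
    (hd : ∀ n, IsLengthDistance (d n)) (hM : 0 ≤ M) (hM' : 0 ≤ M')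
    (h : ∀ n x y, dist x y ≤ M * d n x y) (h₀ : ∀ x y, dist x y ≤ M * d₀ x y)
    (h' : ∀ n x y, d n x y ≤ M' * dist x y)
    (hlim : ∀ x y, Tendsto (fun n => d n x y) atTop (𝓝 (d₀ x y))) :
    GammaConverges (fun n => lipCurves (d n)) (fun n => lengthFunctional (d n))
      (lipCurves d₀) (lengthFunctional d₀) := by
  have hliminf : ∀ (c : ℕ → C(unitInterval, X)) (c₀ : C(unitInterval, X)),
      Tendsto c atTop (𝓝 c₀) →
      lengthFunctional d₀ c₀ ≤ liminf (fun n => lengthFunctional (d n) (c n)) atTop :=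
    fun c c₀ hc => lengthFunctional_le_liminf (fun n => (hd n).1) h' hlim hc
  refine ⟨fun c c₀ _ _ hc => hliminf c c₀ hc, fun c₀ ⟨K₀, hK₀, hc₀⟩ => ?_⟩
  have hK : 0 ≤ M * K₀ := by positivity
  have hlip : ∀ s t, dist (c₀ s) (c₀ t) ≤ M * K₀ * dist s t := fun s t =>
    (h₀ _ _).trans ((mul_le_mul_of_nonneg_left (hc₀ s trivial t trivial) hM).trans_eq
      (mul_assoc _ _ _).symm)
  have hne : ∀ n, (lipCurves (d n)).Nonempty := fun n =>
    ⟨c₀, M' * (M * K₀), by positivity, fun s _ t _ => (h' n _ _).trans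
      ((mul_le_mul_of_nonneg_left (hlip s t) hM').trans_eq (mul_assoc _ _ _).symm)⟩
  -- The excess of length, a truncated difference, needs to be small; the other half of the
  -- convergence of lengths is the lower bound for the inferior limit.
  obtain ⟨c, hcZ, hc⟩ := exists_tendsto_zero_of_eventually_exists_le hne
    (fun n γ => edist γ c₀ + (lengthFunctional (d n) γ - lengthFunctional d₀ c₀)) fun ε hε => by
    have hA : Tendsto (fun N : ℕ => ENNReal.ofReal ((M * (M' * (M * K₀) + 1) + M * K₀) / N) +
        (ENNReal.ofReal (1 / N) + ENNReal.ofReal (1 / N))) atTop (𝓝 0) := by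
      have h1 : ∀ C : ℝ, Tendsto (fun N : ℕ => ENNReal.ofReal (C / N)) atTop (𝓝 0) := fun C => by
        simpa using ENNReal.tendsto_ofReal (tendsto_const_div_atTop_nhds_zero_nat C)
      simpa using (h1 _).add ((h1 1).add (h1 1))
    obtain ⟨N, hNε, hN⟩ :=
      ((ENNReal.tendsto_nhds_zero.1 hA ε hε).and (eventually_gt_atTop 0)).exists
    have hsum : Tendsto (fun n => ∑ i ∈ Finset.range N, ENNReal.ofReal
        (d n (c₀ (unitDivision N i)) (c₀ (unitDivision N (i + 1))))) atTop
        (𝓝 (∑ i ∈ Finset.range N, ENNReal.ofReal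
          (d₀ (c₀ (unitDivision N i)) (c₀ (unitDivision N (i + 1)))))) :=
      tendsto_finsetSum _ fun i _ => ENNReal.tendsto_ofReal (hlim _ _)
    have hlt := ENNReal.lt_add_right
      (ENNReal.sum_ne_top.2 fun i (_ : i ∈ Finset.range N) => ENNReal.ofReal_ne_top
        (r := d₀ (c₀ (unitDivision N i)) (c₀ (unitDivision N (i + 1)))))
      (ENNReal.ofReal_pos.2 (show (0 : ℝ) < 1 / N by positivity)).ne'
    filter_upwards [hsum.eventually_lt_const hlt] with n hn
    obtain ⟨γ, hγ, hdist, hlen⟩ :=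
      (hd n).exists_lipCurve_near hM hM' hK (h n) (h' n) c₀ hlip hN
    refine ⟨γ, hγ, (add_le_add ?_ ?_).trans hNε⟩
    · rw [edist_dist]
      exact ENNReal.ofReal_le_ofReal hdist
    · rw [tsub_le_iff_left, ← add_assoc]
      refine hlen.trans (add_le_add (hn.le.trans (add_le_add ?_ le_rfl)) le_rfl)
      exact sum_le_curveLength d₀ c₀ N (monotone_unitDivision N) fun _ => trivial
  have hcc : Tendsto c atTop (𝓝 c₀) := tendsto_iff_edist_tendsto_0.2
    (tendsto_of_tendsto_of_tendsto_of_le_of_le tendsto_const_nhds hc (fun _ => zero_le)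
      fun _ => le_self_add)
  refine ⟨c, hcZ, hcc, tendsto_of_le_liminf_of_limsup_le (hliminf c c₀ hcc) ?_⟩
  have hexc : Tendsto (fun n => lengthFunctional d₀ c₀ +
      (edist (c n) c₀ + (lengthFunctional (d n) (c n) - lengthFunctional d₀ c₀))) atTop
      (𝓝 (lengthFunctional d₀ c₀)) := by
    simpa using hc.const_add (lengthFunctional d₀ c₀)
  rw [← hexc.limsup_eq]
  exact limsup_le_limsup (.of_forall fun n => le_add_tsub.trans (add_le_add le_rfl le_add_self))

end

/-! ### Distances compatible with a dilatation structure -/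

/-- At the scale `ε = 1` the dilatations are the identity, so that any two distances of the class
are locally comparable with a common tangent distance, with constants not depending on the
distances. -/
theorem DilatationData.IsDilatationStructure.locally_le_mul {X : Type*} [MetricSpace X]
    {S : DilatationData X} (hS : S.IsDilatationStructure) {k₁ C₁ k₂ C₂ : ℝ} (hk : 0 < k₂)
    (hC : 0 ≤ C₁) {d₁ d₂ : X → X → ℝ} (h₁ : d₁ ∈ S.distanceClass k₁ C₁)
    (h₂ : d₂ ∈ S.distanceClass k₂ C₂) (K : Set X) (hK : IsCompact K) :
    ∃ η > 0, ∀ u ∈ K, ∀ v ∈ K, dist u v ≤ η → d₁ u v ≤ C₁ / k₂ * d₂ u v := by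
  obtain ⟨η₁, hη₁, h₁⟩ := h₁.2 1 one_pos K hK
  obtain ⟨η₂, hη₂, h₂⟩ := h₂.2 1 one_pos K hK
  refine ⟨min (min η₁ η₂) 1, by positivity, fun u hu v hv huv => ?_⟩
  have huv₁ : dist u v ≤ η₁ := huv.trans ((min_le_left _ _).trans (min_le_left _ _))
  have huv₂ : dist u v ≤ η₂ := huv.trans ((min_le_left _ _).trans (min_le_right _ _))
  have hA := hS.one_lt_A
  have huU : u ∈ S.U u := hS.closedBall_subset u (Metric.mem_closedBall_self (by linarith))
  have hvU : v ∈ S.U u := hS.closedBall_subset u (by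
    rw [Metric.mem_closedBall, dist_comm]
    exact (huv.trans (min_le_right _ _)).trans hA.le)
  have e₁ := (h₁ u hu u hu v hv (by simpa using hη₁.le) huv₁ huv₁).2
  have e₂ := (h₂ u hu u hu v hv (by simpa using hη₂.le) huv₂ huv₂).1
  rw [hS.map_one u u huU, hS.map_one u v hvU, div_one, one_mul] at e₁ e₂
  calc d₁ u v ≤ C₁ * S.tdist u u v := e₁
    _ ≤ C₁ * (d₂ u v / k₂) := mul_le_mul_of_nonneg_left ((le_div_iff₀' hk).2 e₂) hC
    _ = C₁ / k₂ * d₂ u v := by ring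

theorem theorem43 {Ω : Type*} [MetricSpace Ω] (S : DilatationData Ω)
    (hstrong : S.IsStrong) (htempered : S.IsTempered) (hRN : S.HasRadonNikodym)
    (k C : ℝ) (hk : 0 < k) (hkC : k < C)
    (d : ℕ → Ω → Ω → ℝ) (d₀ : Ω → Ω → ℝ)
    (hd : ∀ n, d n ∈ S.distanceClass k C) (hd₀ : d₀ ∈ S.distanceClass k C)
    (hlim : ∀ K : Set (Ω × Ω), IsCompact K →
      TendstoUniformlyOn (fun n (p : Ω × Ω) => d n p.1 p.2) (fun p => d₀ p.1 p.2) atTop K) :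
    GammaConverges (fun n => lipCurves (d n)) (fun n => lengthFunctional (d n))
      (lipCurves d₀) (lengthFunctional d₀) := by
  obtain ⟨k', C', hk', hkC', hdist⟩ := htempered
  have hS := hstrong.toIsDilatationStructure
  have hC : 0 < C := hk.trans hkC
  have hC' : 0 < C' := hk'.trans hkC'
  have : ProperSpace Ω := properSpace_of_isLengthDistance hdist.1 hS.isCompact_closedBall
  have hupper : ∀ e ∈ S.distanceClass k C, ∀ x y, e x y ≤ C / k' * dist x y := fun e he =>
    he.1.1.le_mul_dist hdist.1 (by positivity) (hS.locally_le_mul hk' hC.le he hdist)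
  have hlower : ∀ e ∈ S.distanceClass k C, ∀ x y, dist x y ≤ C' / k * e x y := fun e he =>
    he.1.dist_le_mul hdist.1.1 (by positivity) (hupper e he) (hS.locally_le_mul hk hC'.le hdist he)
  exact gammaConverges_lengthFunctional (fun n => (hd n).1) (by positivity) (by positivity)
    (fun n => hlower (d n) (hd n)) (hlower d₀ hd₀) (fun n => hupper (d n) (hd n))
    fun x y => (hlim {(x, y)} isCompact_singleton).tendsto_at (mem_singleton (x, y))
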